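/- Let $\mu:(0,\infty)\to[0,\infty)$ be non-increasing, integrable and absolutely continuous on every compact subinterval of $(0,\infty)$ (possibly unbounded near $0$), and suppose that $g(s)=\int_s^\infty\mu(r)\,dr$ satisfies $\int_0^\infty g(s)\,ds=1$. Let $H^1_l(-1,0)=\{u\in H^1(-1,0):u(-1)=0\}$ and $H^1_r(0,1)=\{w\in H^1(0,1):w(1)=0\}$ be the complex Hilbert spaces with norms $\|u'\|_{L^2(-1,0)}$ and $\|w'\|_{L^2(0,1)}$, let $\mathcal M=L^2((0,\infty),\mu(s)ds;H^1_r(0,1))$, and let $$\mathcal H=H^1_l(-1,0)\times L^2(-1,0)\times L^2(0,1)\times\mathcal M$$ with the natural Hilbert space norm. Let $T\eta=-\eta_s$ (weak derivative in $s$) on $\mathcal M$, with $D(T)=\{\eta\in\mathcal M:\eta_s\in\mathcal M,\ \lim_{s\to0}\|\eta(s)\|_{H^1_r(0,1)}=0\}$. For $(u,v,w,\eta)\in\mathcal H$ put $\phi=w+\int_0^\infty\mu(s)\eta(\cdot,s)\,ds$, and let $\mathbb A:D(\mathbb A)\subset\mathcal H\to\mathcal H$ be the operator $$\mathbb A(u,v,w,\eta)=(v,\;u'',\;\phi'',\;T\eta+w),$$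 whose domain $D(\mathbb A)$ consists of the $(u,v,w,\eta)\in\mathcal H$ with $u\in H^2(-1,0)$, $v\in H^1_l(-1,0)$, $w\in H^1_r(0,1)$, $\eta\in D(T)$, $\phi\in H^2(0,1)$, $u'(0)=\phi'(0)$ and $v(0)=w(0)$. If $\sigma(\mathbb A)\subset\{\lambda\in\mathbb C:\operatorname{Re}\lambda<0\}$, then, with $R(is,\mathbb A)=(is-\mathbb A)^{-1}$, $$\limsup_{s\to\infty}\,s^{-1/2}\,\|R(is,\mathbb A)\|>0.$$ -/

import Mathlib

open MeasureTheory Set Filter Topology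
open scoped ContDiff ENNReal

namespace WaveCG

section WeakDeriv

variable {E : Type*} [NormedAddCommGroup E] [NormedSpace ℂ E]

/-- `g` is the weak (distributional) derivative of `f` on the open set `U ⊆ ℝ`. -/
def HasWeakDeriv (U : Set ℝ) (f g : ℝ → E) : Prop :=
  LocallyIntegrableOn f U ∧ LocallyIntegrableOn g U ∧
    ∀ ψ : ℝ → ℝ, ContDiff ℝ ∞ ψ → HasCompactSupport ψ → tsupport ψ ⊆ U →
      ∫ x in U, deriv ψ x • f x = -∫ x in U, ψ x • g x

lemma integrableOn_test_smul {U : Set ℝ} {f : ℝ → E} (hf : LocallyIntegrableOn f U)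
    {ψ : ℝ → ℝ} (hψ : Continuous ψ) (hc : HasCompactSupport ψ) (hs : tsupport ψ ⊆ U) :
    IntegrableOn (fun x => ψ x • f x) U := by
  have h1 : IntegrableOn f (tsupport ψ) := hf.integrableOn_compact_subset hs hc
  have h2 : IntegrableOn (fun x => ψ x • f x) (tsupport ψ) :=
    h1.continuousOn_smul hψ.continuousOn hc
  have h3 : Integrable (fun x => ψ x • f x) := by
    rw [← integrableOn_iff_integrable_of_support_subset (s := tsupport ψ)]
    · exact h2
    · intro x hx
      refine subset_tsupport _ ?_
      simp only [Function.mem_support] at hx ⊢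
      intro h; simp [h] at hx
  exact h3.integrableOn

lemma tsupport_deriv_subset' {ψ : ℝ → ℝ} : tsupport (deriv ψ) ⊆ tsupport ψ :=
  closure_minimal support_deriv_subset (isClosed_tsupport _)

lemma HasWeakDeriv.congr {U : Set ℝ} {f g f' g' : ℝ → E} (h : HasWeakDeriv U f g)
    (hf : f =ᵐ[volume.restrict U] f') (hg : g =ᵐ[volume.restrict U] g') : HasWeakDeriv U f' g' := by
  refine ⟨h.1.congr hf, h.2.1.congr hg, fun ψ h1 h2 h3 => ?_⟩
  have e1 : ∫ x in U, deriv ψ x • f x = ∫ x in U, deriv ψ x • f' x :=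
    integral_congr_ae (by filter_upwards [hf] with x hx; rw [hx])
  have e2 : ∫ x in U, ψ x • g x = ∫ x in U, ψ x • g' x :=
    integral_congr_ae (by filter_upwards [hg] with x hx; rw [hx])
  rw [← e1, ← e2, h.2.2 ψ h1 h2 h3]

lemma HasWeakDeriv.zero (U : Set ℝ) : HasWeakDeriv U (0 : ℝ → E) 0 :=
  ⟨locallyIntegrableOn_zero, locallyIntegrableOn_zero, fun ψ _ _ _ => by simp⟩

lemma HasWeakDeriv.add {U : Set ℝ} {f g f' g' : ℝ → E} (h : HasWeakDeriv U f g)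
    (h' : HasWeakDeriv U f' g') : HasWeakDeriv U (f + f') (g + g') := by
  refine ⟨h.1.add h'.1, h.2.1.add h'.2.1, fun ψ h1 h2 h3 => ?_⟩
  have c' : Continuous (deriv ψ) := h1.continuous_deriv (by simp)
  have s' : tsupport (deriv ψ) ⊆ U := tsupport_deriv_subset'.trans h3
  simp only [Pi.add_apply, smul_add]
  rw [integral_add (integrableOn_test_smul h.1 c' h2.deriv s')
      (integrableOn_test_smul h'.1 c' h2.deriv s'),
    integral_add (integrableOn_test_smul h.2.1 h1.continuous h2 h3)
      (integrableOn_test_smul h'.2.1 h1.continuous h2 h3),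
    h.2.2 ψ h1 h2 h3, h'.2.2 ψ h1 h2 h3, neg_add]

lemma HasWeakDeriv.const_smul {U : Set ℝ} {f g : ℝ → E} (c : ℂ) (h : HasWeakDeriv U f g) :
    HasWeakDeriv U (c • f) (c • g) := by
  refine ⟨h.1.smul c, h.2.1.smul c, fun ψ h1 h2 h3 => ?_⟩
  simp only [Pi.smul_apply, smul_comm _ c]
  rw [integral_smul, integral_smul, h.2.2 ψ h1 h2 h3, smul_neg]

lemma HasWeakDeriv.unique [CompleteSpace E] {U : Set ℝ} (hU : IsOpen U) {f g g' : ℝ → E}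
    (h : HasWeakDeriv U f g) (h' : HasWeakDeriv U f g') : g =ᵐ[volume.restrict U] g' := by
  have key := hU.ae_eq_zero_of_integral_contDiff_smul_eq_zero (h.2.1.sub h'.2.1) (μ := volume) ?_
  · rw [← ae_restrict_iff' hU.measurableSet] at key
    filter_upwards [key] with x hx
    exact sub_eq_zero.1 hx
  · intro ψ h1 h2 h3
    have e : ∫ x in U, ψ x • (g - g') x = ∫ x, ψ x • (g - g') x := by
      apply setIntegral_eq_integral_of_forall_compl_eq_zero
      intro x hx
      rw [image_eq_zero_of_notMem_tsupport (fun hh => hx (h3 hh)), zero_smul]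
    rw [← e]
    simp only [Pi.sub_apply, smul_sub]
    rw [integral_sub (integrableOn_test_smul h.2.1 h1.continuous h2 h3)
      (integrableOn_test_smul h'.2.1 h1.continuous h2 h3), sub_eq_zero, ← neg_inj,
      ← h.2.2 ψ h1 h2 h3, ← h'.2.2 ψ h1 h2 h3]

lemma HasWeakDeriv.const_of_zero {a b : ℝ} (hab : a < b) {f : ℝ → ℂ}
    (h : HasWeakDeriv (Ioo a b) f 0) : ∃ c : ℂ, f =ᵐ[volume.restrict (Ioo a b)] fun _ => c := by
  obtain ⟨χ, hχ⟩ : ∃ χ : ContDiffBump ((a + b) / 2), χ.rOut = (b - a) / 4 :=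
    ⟨⟨(b - a) / 8, (b - a) / 4, by linarith, by linarith⟩, rfl⟩
  have χs : tsupport (χ.normed volume) ⊆ Ioo a b := by
    rw [χ.tsupport_normed_eq, hχ, Real.closedBall_eq_Icc]
    intro x hx; constructor <;> linarith [hx.1, hx.2]
  have χc : HasCompactSupport (χ.normed volume) := χ.hasCompactSupport_normed
  have χd : ContDiff ℝ ∞ (χ.normed volume) := χ.contDiff_normed
  set ρ := χ.normed volume with hρ
  have ρ1 : ∫ x, ρ x = 1 := χ.integral_normed
  set c : ℂ := ∫ x in Ioo a b, ρ x • f x with hc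
  refine ⟨c, ?_⟩
  have lc : LocallyIntegrableOn (fun _ : ℝ => c) (Ioo a b) := locallyIntegrableOn_const c
  have key := isOpen_Ioo.ae_eq_zero_of_integral_contDiff_smul_eq_zero (h.1.sub lc) (μ := volume) ?_
  · rw [← ae_restrict_iff' measurableSet_Ioo] at key
    filter_upwards [key] with x hx
    exact sub_eq_zero.1 hx
  intro θ h1 h2 h3
  set m : ℝ := ∫ x, θ x with hm
  set k : ℝ → ℝ := fun x => θ x - m * ρ x with hk
  have kd : ContDiff ℝ ∞ k := h1.sub (contDiff_const.mul χd)
  have kcomp : IsCompact (tsupport θ ∪ tsupport ρ) := h2.union χc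
  have ksub : tsupport θ ∪ tsupport ρ ⊆ Ioo a b := union_subset h3 χs
  have kz : ∀ x, x ∉ tsupport θ ∪ tsupport ρ → k x = 0 := by
    intro x hx
    simp only [mem_union, not_or] at hx
    simp [hk, image_eq_zero_of_notMem_tsupport hx.1, image_eq_zero_of_notMem_tsupport hx.2]
  have ne : (tsupport θ ∪ tsupport ρ).Nonempty := by
    by_contra hne
    rw [not_nonempty_iff_eq_empty, Set.union_empty_iff] at hne
    have : ρ = 0 := tsupport_eq_empty_iff.1 hne.2
    rw [this] at ρ1; simp at ρ1
  obtain ⟨p, hp, hpm⟩ := kcomp.exists_isLeast ne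
  obtain ⟨q, hq, hqm⟩ := kcomp.exists_isGreatest ne
  have kz' : ∀ x, x ∉ Icc p q → k x = 0 := fun x hx =>
    kz x (fun hh => hx ⟨hpm hh, hqm hh⟩)
  have kint : Integrable k :=
    (h1.continuous.integrable_of_hasCompactSupport h2).sub
      ((χd.continuous.integrable_of_hasCompactSupport χc).const_mul m)
  have k0 : ∫ x, k x = 0 := by
    rw [hk, integral_sub (h1.continuous.integrable_of_hasCompactSupport h2)
      ((χd.continuous.integrable_of_hasCompactSupport χc).const_mul m), integral_const_mul, ρ1]
    simp [hm]
  set K : ℝ → ℝ := fun x => ∫ t in a..x, k t with hK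
  have Kd : ∀ x, HasDerivAt K (k x) x := fun x =>
    intervalIntegral.integral_hasDerivAt_right (kd.continuous.intervalIntegrable _ _)
      (kd.continuous.stronglyMeasurableAtFilter _ _) kd.continuous.continuousAt
  have Kder : deriv K = k := funext fun x => (Kd x).deriv
  have KC : ContDiff ℝ ∞ K := by
    rw [contDiff_infty_iff_deriv]
    exact ⟨fun x => (Kd x).differentiableAt, by rw [Kder]; exact kd⟩
  have ap : a < p := (ksub hp).1
  have qb : q < b := (ksub hq).2
  have Kz : ∀ x, x ∉ Icc p q → K x = 0 := by
    intro x hx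
    rw [mem_Icc, not_and_or, not_le, not_le] at hx
    rcases hx with hx | hx
    · rw [hK]
      dsimp only
      rw [intervalIntegral.integral_congr (g := fun _ => (0 : ℝ))]
      · simp
      · intro t ht
        apply kz'
        intro h'
        have := (uIcc_subset_Icc (a₂ := min a x) (b₂ := max a x)
          ⟨min_le_left _ _, le_max_left _ _⟩ ⟨min_le_right _ _, le_max_right _ _⟩ ht).2
        have : t < p := lt_of_le_of_lt this (max_lt ap hx)
        linarith [h'.1]
    · have ax : a ≤ x := by linarith [(ksub hq).1]
      rw [hK]
      dsimp only
      rw [intervalIntegral.integral_of_le ax, ← k0]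
      apply setIntegral_eq_integral_of_forall_compl_eq_zero
      intro t ht
      apply kz'
      intro h'
      exact ht ⟨by linarith [h'.1], by linarith [h'.2]⟩
  have Ks : tsupport K ⊆ Icc p q := by
    apply closure_minimal _ isClosed_Icc
    intro x hx
    by_contra h'
    exact hx (Kz x h')
  have Kc : HasCompactSupport K := HasCompactSupport.of_support_subset_isCompact isCompact_Icc
    (subset_closure.trans Ks)
  have Ksub : tsupport K ⊆ Ioo a b := Ks.trans fun x hx => ⟨by linarith [hx.1], by linarith [hx.2]⟩
  have eq1 := h.2.2 K KC Kc Ksub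
  simp only [Kder, Pi.zero_apply, smul_zero, integral_zero, neg_zero] at eq1
  have i1 := integrableOn_test_smul h.1 h1.continuous h2 h3
  have i2 := integrableOn_test_smul h.1 χd.continuous χc χs
  have e1 : ∫ x in Ioo a b, θ x • f x = (m : ℂ) * c := by
    have : (fun x => k x • f x) = fun x => θ x • f x - m • (ρ x • f x) := by
      ext x; simp only [hk, sub_smul, mul_smul]
    have i3 : IntegrableOn (fun x => m • (ρ x • f x)) (Ioo a b) := i2.smul m
    rw [this, integral_sub i1 i3, integral_smul, sub_eq_zero] at eq1
    rw [eq1, Complex.real_smul]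
  have e2 : ∫ x in Ioo a b, θ x = m := by
    apply setIntegral_eq_integral_of_forall_compl_eq_zero
    intro x hx
    exact image_eq_zero_of_notMem_tsupport (fun hh => hx (h3 hh))
  have e : ∫ x in Ioo a b, θ x • (f x - c) = ∫ x, θ x • (f x - c) := by
    apply setIntegral_eq_integral_of_forall_compl_eq_zero
    intro x hx
    rw [image_eq_zero_of_notMem_tsupport (fun hh => hx (h3 hh)), zero_smul]
  change ∫ x, θ x • (f x - c) = 0
  rw [← e]
  simp only [smul_sub]
  rw [integral_sub i1 (integrableOn_test_smul lc h1.continuous h2 h3), e1,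
    integral_smul_const, e2, Complex.real_smul, sub_self]

lemma hasWeakDeriv_const {a b : ℝ} (c : ℂ) : HasWeakDeriv (Ioo a b) (fun _ => c) 0 := by
  refine ⟨locallyIntegrableOn_const c, locallyIntegrableOn_zero, fun ψ h1 h2 h3 => ?_⟩
  have : ∫ x in Ioo a b, deriv ψ x = ∫ x, deriv ψ x := by
    apply setIntegral_eq_integral_of_forall_compl_eq_zero
    intro x hx
    exact image_eq_zero_of_notMem_tsupport (fun hh => hx (h3 (tsupport_deriv_subset' hh)))
  rw [integral_smul_const, this, integral_eq_zero_of_hasDerivAt_of_integrable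
    (fun x => (h1.differentiable (by simp) x).hasDerivAt)
    ((h1.continuous_deriv (by simp)).integrable_of_hasCompactSupport h2.deriv)
    (h1.continuous.integrable_of_hasCompactSupport h2)]
  simp

lemma hasWeakDeriv_primitive {a b : ℝ} (hab : a < b) {g : ℝ → ℂ} (hg : IntegrableOn g (Ioo a b))
    {c : ℝ} (hc : c ∈ Icc a b) :
    HasWeakDeriv (Ioo a b) (fun x => ∫ t in c..x, g t) g := by
  have hg' : IntegrableOn g (Icc a b) := by rwa [integrableOn_Icc_iff_integrableOn_Ioo]
  have hI : ∀ x ∈ Icc a b, ∀ y ∈ Icc a b, IntervalIntegrable g volume x y := by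
    intro x hx y hy
    rw [intervalIntegrable_iff']
    exact hg'.mono_set (uIcc_subset_Icc hx hy)
  have ha : a ∈ Icc a b := ⟨le_rfl, hab.le⟩
  have hb : b ∈ Icc a b := ⟨hab.le, le_rfl⟩
  have base : HasWeakDeriv (Ioo a b) (fun x => ∫ t in a..x, g t) g := by
    have hcont : ContinuousOn (fun x => ∫ t in a..x, g t) (Icc a b) := by
      have := intervalIntegral.continuousOn_primitive_interval (μ := volume) (f := g) (a := a)
        (b := b) (by rw [uIcc_of_le hab.le]; exact hg')
      rwa [uIcc_of_le hab.le] at this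
    refine ⟨(hcont.mono Ioo_subset_Icc_self).locallyIntegrableOn measurableSet_Ioo,
      hg.locallyIntegrableOn, fun ψ h1 h2 h3 => ?_⟩
    have dc : Continuous (deriv ψ) := h1.continuous_deriv (by simp)
    have ψb : ψ b = 0 := image_eq_zero_of_notMem_tsupport (fun hh => lt_irrefl _ (h3 hh).2)
    have i1 : IntegrableOn (deriv ψ) (Ioo a b) :=
      (dc.integrable_of_hasCompactSupport h2.deriv).integrableOn
    have i2 : Integrable (fun z : ℝ × ℝ => deriv ψ z.1 • g z.2)
        ((volume.restrict (Ioo a b)).prod (volume.restrict (Ioo a b))) := i1.smul_prod hg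
    have i3 : Integrable (fun z : ℝ × ℝ =>
        ({z : ℝ × ℝ | z.2 < z.1}.indicator (fun z => deriv ψ z.1 • g z.2)) z)
        ((volume.restrict (Ioo a b)).prod (volume.restrict (Ioo a b))) :=
      i2.indicator (measurableSet_lt measurable_snd measurable_fst)
    have sw := integral_integral_swap (f := fun x t =>
      ({z : ℝ × ℝ | z.2 < z.1}.indicator (fun z => deriv ψ z.1 • g z.2)) (x, t)) i3
    have l : ∀ x ∈ Ioo a b, ∫ t in Ioo a b,
        ({z : ℝ × ℝ | z.2 < z.1}.indicator (fun z => deriv ψ z.1 • g z.2)) (x, t)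
        = deriv ψ x • ∫ t in a..x, g t := by
      intro x hx
      rw [intervalIntegral.integral_of_le hx.1.le, integral_Ioc_eq_integral_Ioo, ← integral_smul]
      have : (fun t => ({z : ℝ × ℝ | z.2 < z.1}.indicator (fun z => deriv ψ z.1 • g z.2)) (x, t))
          = (Iio x).indicator (fun t => deriv ψ x • g t) := by
        ext t; simp [indicator]
      rw [this, setIntegral_indicator measurableSet_Iio, Ioo_inter_Iio, min_eq_right hx.2.le]
    have r : ∀ t ∈ Ioo a b, ∫ x in Ioo a b,
        ({z : ℝ × ℝ | z.2 < z.1}.indicator (fun z => deriv ψ z.1 • g z.2)) (x, t)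
        = -(ψ t • g t) := by
      intro t ht
      have : (fun x => ({z : ℝ × ℝ | z.2 < z.1}.indicator (fun z => deriv ψ z.1 • g z.2)) (x, t))
          = (Ioi t).indicator (fun x => deriv ψ x • g t) := by
        ext x; simp [indicator]
      rw [this, setIntegral_indicator measurableSet_Ioi, Ioo_inter_Ioi, max_eq_right ht.1.le,
        integral_smul_const, ← integral_Ioc_eq_integral_Ioo,
        ← intervalIntegral.integral_of_le ht.2.le,
        intervalIntegral.integral_deriv_eq_sub (fun x _ => h1.differentiable (by simp) x)
          (dc.intervalIntegrable _ _), ψb, zero_sub, neg_smul]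
    rw [← setIntegral_congr_fun measurableSet_Ioo l, sw, setIntegral_congr_fun measurableSet_Ioo r,
      integral_neg]
  refine (base.add (hasWeakDeriv_const (-∫ t in a..c, g t))).congr ?_ ?_
  · filter_upwards [ae_restrict_mem measurableSet_Ioo] with x hx
    have := intervalIntegral.integral_add_adjacent_intervals (hI a ha c hc)
      (hI c hc x (Ioo_subset_Icc_self hx))
    simp only [Pi.add_apply]
    rw [← this]; ring
  · simp

end WeakDeriv

section Sobolev

/-- The complex Hilbert space `L²(a, b)`. -/
noncomputable abbrev L2 (a b : ℝ) := Lp ℂ 2 (volume.restrict (Ioo a b))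

lemma L2.integrableOn {a b : ℝ} (f : L2 a b) : IntegrableOn f (Ioo a b) :=
  (Lp.memLp f).integrable one_le_two

/-- `f ∈ L²(a, b)` has a weak derivative in `L²(a, b)`, that is `f ∈ H¹(a, b)`. -/
def IsH1 {a b : ℝ} (f : L2 a b) : Prop := ∃ g : L2 a b, HasWeakDeriv (Ioo a b) f g

open Classical in
/-- The weak derivative `f' ∈ L²(a, b)` of `f ∈ H¹(a, b)` (and `0` if `f ∉ H¹(a, b)`). -/
noncomputable def wderiv {a b : ℝ} (f : L2 a b) : L2 a b :=
  if h : IsH1 f then h.choose else 0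

lemma wderiv_spec {a b : ℝ} {f : L2 a b} (h : IsH1 f) : HasWeakDeriv (Ioo a b) f (wderiv f) := by
  rw [wderiv, dif_pos h]; exact h.choose_spec

lemma wderiv_eq {a b : ℝ} {f g : L2 a b} (h : HasWeakDeriv (Ioo a b) f g) : wderiv f = g :=
  Lp.ext ((wderiv_spec ⟨g, h⟩).unique isOpen_Ioo h)

lemma hasWeakDeriv_zero_L2 {a b : ℝ} :
    HasWeakDeriv (Ioo a b) (0 : L2 a b) (0 : L2 a b) :=
  (HasWeakDeriv.zero (Ioo a b)).congr (Lp.coeFn_zero ..).symm (Lp.coeFn_zero ..).symm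

lemma hasWeakDeriv_add_L2 {a b : ℝ} {f g f' g' : L2 a b} (h : HasWeakDeriv (Ioo a b) f g)
    (h' : HasWeakDeriv (Ioo a b) f' g') :
    HasWeakDeriv (Ioo a b) (f + f' : L2 a b) (g + g' : L2 a b) :=
  (h.add h').congr (Lp.coeFn_add ..).symm (Lp.coeFn_add ..).symm

lemma hasWeakDeriv_smul_L2 {a b : ℝ} (c : ℂ) {f g : L2 a b} (h : HasWeakDeriv (Ioo a b) f g) :
    HasWeakDeriv (Ioo a b) (c • f : L2 a b) (c • g : L2 a b) :=
  (h.const_smul c).congr (Lp.coeFn_smul ..).symm (Lp.coeFn_smul ..).symm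

lemma IsH1.zero {a b : ℝ} : IsH1 (0 : L2 a b) := ⟨0, hasWeakDeriv_zero_L2⟩

lemma IsH1.add {a b : ℝ} {f g : L2 a b} (hf : IsH1 f) (hg : IsH1 g) : IsH1 (f + g) :=
  ⟨_, hasWeakDeriv_add_L2 (wderiv_spec hf) (wderiv_spec hg)⟩

lemma IsH1.smul {a b : ℝ} (c : ℂ) {f : L2 a b} (hf : IsH1 f) : IsH1 (c • f) :=
  ⟨_, hasWeakDeriv_smul_L2 c (wderiv_spec hf)⟩

lemma wderiv_zero {a b : ℝ} : wderiv (0 : L2 a b) = 0 := wderiv_eq hasWeakDeriv_zero_L2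

lemma wderiv_add {a b : ℝ} {f g : L2 a b} (hf : IsH1 f) (hg : IsH1 g) :
    wderiv (f + g) = wderiv f + wderiv g :=
  wderiv_eq (hasWeakDeriv_add_L2 (wderiv_spec hf) (wderiv_spec hg))

lemma wderiv_smul {a b : ℝ} (c : ℂ) {f : L2 a b} (hf : IsH1 f) :
    wderiv (c • f) = c • wderiv f :=
  wderiv_eq (hasWeakDeriv_smul_L2 c (wderiv_spec hf))

/-- `f ∈ H²(a, b)`: both `f` and its weak derivative `f'` belong to `H¹(a, b)`. -/
def IsH2 {a b : ℝ} (f : L2 a b) : Prop := IsH1 f ∧ IsH1 (wderiv f)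

lemma IsH2.zero {a b : ℝ} : IsH2 (0 : L2 a b) := ⟨.zero, by rw [wderiv_zero]; exact .zero⟩

lemma IsH2.add {a b : ℝ} {f g : L2 a b} (hf : IsH2 f) (hg : IsH2 g) : IsH2 (f + g) :=
  ⟨hf.1.add hg.1, by rw [wderiv_add hf.1 hg.1]; exact hf.2.add hg.2⟩

lemma IsH2.smul {a b : ℝ} (c : ℂ) {f : L2 a b} (hf : IsH2 f) : IsH2 (c • f) :=
  ⟨hf.1.smul c, by rw [wderiv_smul c hf.1]; exact hf.2.smul c⟩

/-- The class `f ∈ L²(a, b)` has a representative that is continuous on `[a, b]`, and this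
representative takes the value `y` at the point `c ∈ [a, b]`. -/
def HasValueAt {a b : ℝ} (f : L2 a b) (c : ℝ) (y : ℂ) : Prop :=
  ∃ F : ℝ → ℂ, ContinuousOn F (Icc a b) ∧ f =ᵐ[volume.restrict (Ioo a b)] F ∧ F c = y

lemma HasValueAt.zero {a b c : ℝ} : HasValueAt (0 : L2 a b) c 0 :=
  ⟨0, continuousOn_const, Lp.coeFn_zero .., rfl⟩

lemma HasValueAt.add {a b c : ℝ} {f g : L2 a b} {y y' : ℂ} (hf : HasValueAt f c y)
    (hg : HasValueAt g c y') : HasValueAt (f + g) c (y + y') := by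
  obtain ⟨F, F1, F2, rfl⟩ := hf
  obtain ⟨G, G1, G2, rfl⟩ := hg
  exact ⟨F + G, F1.add G1, (Lp.coeFn_add f g).trans (F2.add G2), rfl⟩

lemma HasValueAt.smul {a b c : ℝ} {f : L2 a b} {y : ℂ} (k : ℂ) (hf : HasValueAt f c y) :
    HasValueAt (k • f) c (k • y) := by
  obtain ⟨F, F1, F2, rfl⟩ := hf
  exact ⟨k • F, F1.const_smul k, (Lp.coeFn_smul k f).trans (F2.const_smul k), rfl⟩

/-- The functions in `H¹(a, b)` that vanish at the point `c ∈ [a, b]`. -/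
def h1Vanish (a b c : ℝ) : Submodule ℂ (L2 a b) where
  carrier := {f | IsH1 f ∧ HasValueAt f c 0}
  zero_mem' := ⟨.zero, .zero⟩
  add_mem' hf hg := ⟨hf.1.add hg.1, by simpa using hf.2.add hg.2⟩
  smul_mem' k _ hf := ⟨hf.1.smul k, by simpa using hf.2.smul k⟩

/-- `a < b` and `c ∈ [a, b]`. -/
class PointOfInterval (a b c : ℝ) : Prop where
  lt : a < b
  mem : c ∈ Icc a b

instance : PointOfInterval (-1) 0 (-1) := ⟨by norm_num, by norm_num⟩
instance : PointOfInterval 0 1 1 := ⟨by norm_num, by norm_num⟩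

/-- The space of `φ ∈ H¹(a, b)` with `φ(c) = 0`. It is a type of its own, and not a subtype of
`L²(a, b)`, because it carries the inner product `⟨φ', ψ'⟩` of `L²(a, b)`. -/
def H1V (a b c : ℝ) : Type := h1Vanish a b c

namespace H1V

variable {a b c : ℝ}

noncomputable instance : AddCommGroup (H1V a b c) := inferInstanceAs (AddCommGroup (h1Vanish a b c))
noncomputable instance : Module ℂ (H1V a b c) := inferInstanceAs (Module ℂ (h1Vanish a b c))

/-- The inclusion of `H1V a b c` in `L²(a, b)`. -/
noncomputable def toL2 : H1V a b c →ₗ[ℂ] L2 a b := (h1Vanish a b c).subtype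

/-- A function in `H¹(a, b)` that vanishes at `c`, as an element of `H1V a b c`. -/
def mk (f : L2 a b) (h : f ∈ h1Vanish a b c) : H1V a b c := ⟨f, h⟩

/-- The derivative `φ ↦ φ'` from `H1V a b c` to `L²(a, b)`. -/
noncomputable def D : H1V a b c →ₗ[ℂ] L2 a b where
  toFun f := wderiv (toL2 f)
  map_add' f g := by rw [map_add]; exact wderiv_add f.2.1 g.2.1
  map_smul' k f := by rw [map_smul]; exact wderiv_smul k f.2.1

lemma D_injective [hp : PointOfInterval a b c] :
    Function.Injective (D : H1V a b c → L2 a b) := by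
  rw [← LinearMap.coe_coe, injective_iff_map_eq_zero]
  rintro ⟨f, hf, F, F1, F2, F3⟩ h
  have h0 : HasWeakDeriv (Ioo a b) f (0 : L2 a b) := by
    rw [← show wderiv f = 0 from h]; exact wderiv_spec hf
  obtain ⟨k, hk⟩ := (h0.congr (.refl _ _) (Lp.coeFn_zero ..)).const_of_zero hp.lt
  have e1 : EqOn F (fun _ => k) (Ioo a b) :=
    Measure.eqOn_Ioo_of_ae_eq (volume : Measure ℝ) (F2.symm.trans hk)
      (F1.mono Ioo_subset_Icc_self) continuousOn_const
  have e2 : EqOn F (fun _ => k) (Icc a b) :=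
    e1.of_subset_closure F1 continuousOn_const Ioo_subset_Icc_self
      (by rw [closure_Ioo hp.lt.ne])
  have k0 : k = 0 := by rw [← F3]; exact (e2 hp.mem).symm
  subst k0
  exact Subtype.ext (Lp.ext (hk.trans (Lp.coeFn_zero ..).symm))

lemma D_surjective [hp : PointOfInterval a b c] :
    Function.Surjective (D : H1V a b c → L2 a b) := by
  intro g
  have hg' : IntegrableOn g (uIcc a b) := by
    rw [uIcc_of_le hp.lt.le, integrableOn_Icc_iff_integrableOn_Ioo]; exact (L2.integrableOn g)
  have hc : ContinuousOn (fun x => ∫ t in c..x, g t) (Icc a b) := by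
    have := intervalIntegral.continuousOn_primitive_interval' (μ := volume) (f := g) (a := c)
      (b₁ := a) (b₂ := b) (hg'.intervalIntegrable) (by rw [uIcc_of_le hp.lt.le]; exact hp.mem)
    rwa [uIcc_of_le hp.lt.le] at this
  obtain ⟨C, hC⟩ := isCompact_Icc.exists_bound_of_continuousOn hc
  have hL : MemLp (fun x => ∫ t in c..x, g t) 2 (volume.restrict (Ioo a b)) :=
    MemLp.of_bound ((hc.mono Ioo_subset_Icc_self).aestronglyMeasurable measurableSet_Ioo) C
      (by filter_upwards [ae_restrict_mem measurableSet_Ioo] with x hx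
          exact hC x (Ioo_subset_Icc_self hx))
  have hw : HasWeakDeriv (Ioo a b) hL.toLp g :=
    (hasWeakDeriv_primitive hp.lt (L2.integrableOn g) hp.mem).congr hL.coeFn_toLp.symm (.refl _ _)
  exact ⟨mk hL.toLp ⟨⟨g, hw⟩, _, hc, hL.coeFn_toLp, intervalIntegral.integral_same⟩, wderiv_eq hw⟩

variable [PointOfInterval a b c]

noncomputable instance : NormedAddCommGroup (H1V a b c) :=
  NormedAddCommGroup.induced _ (L2 a b) D D_injective

/-- The inner product `⟨φ, ψ⟩ = ⟨φ', ψ'⟩`, so that `‖φ‖ = ‖φ'‖`. -/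
noncomputable instance : InnerProductSpace ℂ (H1V a b c) where
  norm_smul_le k f := by
    change ‖D (k • f)‖ ≤ ‖k‖ * ‖D f‖
    rw [map_smul]; exact norm_smul_le k (D f)
  inner f g := inner ℂ (D f) (D g)
  norm_sq_eq_re_inner f := InnerProductSpace.norm_sq_eq_re_inner (𝕜 := ℂ) (D f)
  conj_inner_symm f g := InnerProductSpace.conj_inner_symm (D f) (D g)
  add_left f g h := by rw [map_add]; exact InnerProductSpace.add_left _ _ _
  smul_left f g k := by rw [map_smul]; exact InnerProductSpace.smul_left _ _ _

instance : CompleteSpace (H1V a b c) :=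
  (IsometryEquiv.mk (Equiv.ofBijective (D : H1V a b c → L2 a b) ⟨D_injective, D_surjective⟩)
    (AddMonoidHomClass.isometry_of_norm (D : H1V a b c →ₗ[ℂ] L2 a b) fun _ => rfl)).completeSpace

end H1V

/-- `H¹_l(-1, 0)`: functions in `H¹(-1, 0)` vanishing at `-1`. -/
noncomputable abbrev H1l := H1V (-1) 0 (-1)

/-- `H¹_r(0, 1)`: functions in `H¹(0, 1)` vanishing at `1`. -/
noncomputable abbrev H1r := H1V 0 1 1

end Sobolev

section Memory

/-- The data of the memory kernel: `μ : (0, ∞) → [0, ∞)` is non-increasing, (locally) absolutely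
continuous and integrable, possibly unbounded near `0`, and `g(s) = ∫_s^∞ μ(r) dr` has total
mass one. The values of `μ` outside `(0, ∞)` play no role. -/
structure MemoryKernel where
  μ : ℝ → ℝ
  nonneg : ∀ s, 0 < s → 0 ≤ μ s
  antitone : AntitoneOn μ (Ioi 0)
  absCont : ∀ a b, 0 < a → a ≤ b → AbsolutelyContinuousOnInterval μ a b
  integrable : IntegrableOn μ (Ioi 0)
  mass : ∫ s in Ioi (0 : ℝ), ∫ r in Ioi s, μ r = 1

namespace MemoryKernel

variable (k : MemoryKernel)

/-- The measure `μ(s) ds` on `(0, ∞)`. -/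
noncomputable def measure : Measure ℝ :=
  (volume.restrict (Ioi 0)).withDensity fun s => ENNReal.ofReal (k.μ s)

instance : IsFiniteMeasure k.measure := isFiniteMeasure_withDensity_ofReal k.integrable.2

/-- The set `{s > 0 : μ(s) > 0}`, an open interval with left endpoint `0`. It carries the measure
`μ(s) ds`, so that elements of the memory space are determined on this set only. -/
def posSet : Set ℝ := {s | 0 < s ∧ 0 < k.μ s}

lemma isOpen_posSet : IsOpen k.posSet := by
  rw [isOpen_iff_mem_nhds]
  rintro s ⟨hs, hμ⟩
  have h1 := (k.absCont (s / 2) (2 * s) (by linarith) (by linarith)).continuousOn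
  rw [uIcc_of_le (by linarith)] at h1
  have h2 : ContinuousAt k.μ s := h1.continuousAt (Icc_mem_nhds (by linarith) (by linarith))
  exact (lt_mem_nhds hs).and (h2.eventually (lt_mem_nhds hμ))

lemma ae_measure_iff {p : ℝ → Prop} :
    (∀ᵐ s ∂k.measure, p s) ↔ ∀ᵐ s ∂volume.restrict k.posSet, p s := by
  rw [measure, ae_withDensity_iff' k.integrable.aemeasurable.ennreal_ofReal,
    ae_restrict_iff' measurableSet_Ioi, ae_restrict_iff' k.isOpen_posSet.measurableSet]
  simp [posSet, and_imp]

/-- The memory space `ℳ = L²_μ(0, ∞; H¹_r(0, 1))`. -/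
noncomputable abbrev M := Lp H1r 2 k.measure

lemma integrable_M (η : k.M) : Integrable η k.measure := (Lp.memLp η).integrable one_le_two

/-- `η ∈ ℳ` has a weak derivative `η_s ∈ ℳ`. -/
def HasMemDeriv (η : k.M) : Prop := ∃ ξ : k.M, HasWeakDeriv k.posSet η ξ

open Classical in
/-- The weak derivative `η_s ∈ ℳ` (and `0` if there is none). -/
noncomputable def memDeriv (η : k.M) : k.M := if h : k.HasMemDeriv η then h.choose else 0

variable {k}

lemma memDeriv_spec {η : k.M} (h : k.HasMemDeriv η) : HasWeakDeriv k.posSet η (k.memDeriv η) := by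
  rw [memDeriv, dif_pos h]; exact h.choose_spec

lemma memDeriv_eq {η ξ : k.M} (h : HasWeakDeriv k.posSet η ξ) : k.memDeriv η = ξ :=
  Lp.ext (k.ae_measure_iff.2 ((memDeriv_spec ⟨ξ, h⟩).unique k.isOpen_posSet h))

lemma hasWeakDeriv_add_M {f g f' g' : k.M} (h : HasWeakDeriv k.posSet f g)
    (h' : HasWeakDeriv k.posSet f' g') :
    HasWeakDeriv k.posSet (f + f' : k.M) (g + g' : k.M) :=
  (h.add h').congr (k.ae_measure_iff.1 (Lp.coeFn_add f f').symm)
    (k.ae_measure_iff.1 (Lp.coeFn_add g g').symm)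

lemma hasWeakDeriv_smul_M (c : ℂ) {f g : k.M} (h : HasWeakDeriv k.posSet f g) :
    HasWeakDeriv k.posSet (c • f : k.M) (c • g : k.M) :=
  (h.const_smul c).congr (k.ae_measure_iff.1 (Lp.coeFn_smul c f).symm)
    (k.ae_measure_iff.1 (Lp.coeFn_smul c g).symm)

lemma hasWeakDeriv_zero_M : HasWeakDeriv k.posSet (0 : k.M) (0 : k.M) :=
  (HasWeakDeriv.zero k.posSet).congr (k.ae_measure_iff.1 (Lp.coeFn_zero ..).symm)
    (k.ae_measure_iff.1 (Lp.coeFn_zero ..).symm)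

variable (k)

/-- `‖η(s)‖ → 0` as `s → 0`, for the continuous representative of `η`. -/
def VanishesAtZero (η : k.M) : Prop :=
  ∃ F : ℝ → H1r, ContinuousOn F k.posSet ∧ η =ᵐ[k.measure] F ∧
    Tendsto (fun s => ‖F s‖) (𝓝[>] 0) (𝓝 0)

/-- The operator `T η = -η_s` on `ℳ`, whose domain consists of the `η ∈ ℳ` with `η_s ∈ ℳ` and
`‖η(s)‖ → 0` as `s → 0`. -/
noncomputable def T : k.M →ₗ.[ℂ] k.M where
  domain :=
    { carrier := {η | k.HasMemDeriv η ∧ k.VanishesAtZero η}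
      zero_mem' := ⟨⟨0, hasWeakDeriv_zero_M⟩, 0, continuousOn_const, Lp.coeFn_zero .., by simp⟩
      add_mem' := by
        rintro η ξ ⟨hη, F, F1, F2, F3⟩ ⟨hξ, G, G1, G2, G3⟩
        refine ⟨⟨_, hasWeakDeriv_add_M (memDeriv_spec hη) (memDeriv_spec hξ)⟩, F + G, F1.add G1,
          (Lp.coeFn_add η ξ).trans (F2.add G2), ?_⟩
        have h := F3.add G3
        rw [add_zero] at h
        exact squeeze_zero (fun _ => norm_nonneg _) (fun s => norm_add_le (F s) (G s)) h
      smul_mem' := by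
        rintro c η ⟨hη, F, F1, F2, F3⟩
        refine ⟨⟨_, hasWeakDeriv_smul_M c (memDeriv_spec hη)⟩, c • F, F1.const_smul c,
          (Lp.coeFn_smul c η).trans (F2.const_smul c), ?_⟩
        have h := F3.const_mul ‖c‖
        rw [mul_zero] at h
        simpa only [Pi.smul_apply, norm_smul] using h }
  toFun :=
    { toFun := fun η => -k.memDeriv η
      map_add' := fun η ξ => by
        rw [Submodule.coe_add, memDeriv_eq (hasWeakDeriv_add_M (memDeriv_spec η.2.1)
          (memDeriv_spec ξ.2.1)), neg_add]
      map_smul' := fun c η => by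
        rw [Submodule.coe_smul, memDeriv_eq (hasWeakDeriv_smul_M c (memDeriv_spec η.2.1)),
          smul_neg, RingHom.id_apply] }

/-- `φ = w + ∫_0^∞ μ(s) η(s) ds`, as an element of `L²(0, 1)`; the integral is taken in
`H¹_r(0, 1)`. -/
noncomputable def phi (w : L2 0 1) (η : k.M) : L2 0 1 :=
  w + H1V.toL2 (∫ s, η s ∂k.measure)

lemma phi_add (w w' : L2 0 1) (η η' : k.M) : k.phi (w + w') (η + η') = k.phi w η + k.phi w' η' := by
  have h : ∫ s, (η + η' : k.M) s ∂k.measure = ∫ s, η s ∂k.measure + ∫ s, η' s ∂k.measure := by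
    rw [← integral_add (k.integrable_M η) (k.integrable_M η')]
    exact integral_congr_ae (Lp.coeFn_add η η')
  rw [phi, h, map_add, phi, phi]; abel

lemma phi_smul (c : ℂ) (w : L2 0 1) (η : k.M) : k.phi (c • w) (c • η) = c • k.phi w η := by
  have h : ∫ s, (c • η : k.M) s ∂k.measure = c • ∫ s, η s ∂k.measure := by
    rw [← integral_smul]
    exact integral_congr_ae (Lp.coeFn_smul c η)
  rw [phi, h, map_smul, phi, smul_add]

lemma phi_zero : k.phi 0 0 = 0 := by simpa using k.phi_smul 0 0 0

/-- The state space `ℋ = H¹_l(-1, 0) × L²(-1, 0) × L²(0, 1) × ℳ` with the inner product of the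
Hilbert space direct sum. -/
noncomputable abbrev StateSpace := WithLp 2 (H1l × WithLp 2 (L2 (-1) 0 × WithLp 2 (L2 0 1 × k.M)))

variable {k}

/-- The components of a state `z = (u, v, w, η)`. -/
def StateSpace.u (z : k.StateSpace) : H1l := z.fst
def StateSpace.v (z : k.StateSpace) : L2 (-1) 0 := z.snd.fst
def StateSpace.w (z : k.StateSpace) : L2 0 1 := z.snd.snd.fst
def StateSpace.η (z : k.StateSpace) : k.M := z.snd.snd.snd

/-- The function `φ` belonging to a state. -/
noncomputable def StateSpace.φ (z : k.StateSpace) : L2 0 1 := k.phi (StateSpace.w z) (StateSpace.η z)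

/-- The conditions that define the domain of the system operator. -/
structure InDomain (z : k.StateSpace) : Prop where
  u_mem : IsH2 (H1V.toL2 (StateSpace.u z))
  v_mem : StateSpace.v z ∈ h1Vanish (-1) 0 (-1)
  w_mem : StateSpace.w z ∈ h1Vanish 0 1 1
  η_mem : StateSpace.η z ∈ k.T.domain
  φ_mem : IsH2 (StateSpace.φ z)
  /-- `u'(0) = φ'(0)` -/
  flux : ∃ y, HasValueAt (wderiv (H1V.toL2 (StateSpace.u z))) 0 y ∧
    HasValueAt (wderiv (StateSpace.φ z)) 0 y
  /-- `v(0) = w(0)` -/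
  velocity : ∃ y, HasValueAt (StateSpace.v z) 0 y ∧ HasValueAt (StateSpace.w z) 0 y

lemma InDomain.zero : InDomain (0 : k.StateSpace) where
  u_mem := IsH2.zero
  v_mem := Submodule.zero_mem _
  w_mem := Submodule.zero_mem _
  η_mem := Submodule.zero_mem _
  φ_mem := by rw [show StateSpace.φ (0 : k.StateSpace) = 0 from k.phi_zero]; exact .zero
  flux := by
    refine ⟨0, ?_, ?_⟩
    · rw [show H1V.toL2 (StateSpace.u (0 : k.StateSpace)) = 0 from rfl, wderiv_zero]; exact .zero
    · rw [show StateSpace.φ (0 : k.StateSpace) = 0 from k.phi_zero, wderiv_zero]; exact .zero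
  velocity := ⟨0, HasValueAt.zero, HasValueAt.zero⟩

lemma StateSpace.φ_add (z z' : k.StateSpace) :
    StateSpace.φ (z + z') = StateSpace.φ z + StateSpace.φ z' := k.phi_add ..

lemma StateSpace.φ_smul (c : ℂ) (z : k.StateSpace) :
    StateSpace.φ (c • z) = c • StateSpace.φ z := k.phi_smul ..

lemma StateSpace.u_add (z z' : k.StateSpace) :
    H1V.toL2 (StateSpace.u (z + z')) = H1V.toL2 (StateSpace.u z) + H1V.toL2 (StateSpace.u z') := rfl

lemma StateSpace.u_smul (c : ℂ) (z : k.StateSpace) :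
    H1V.toL2 (StateSpace.u (c • z)) = c • H1V.toL2 (StateSpace.u z) := rfl

lemma InDomain.add {z z' : k.StateSpace} (h : InDomain z) (h' : InDomain z') :
    InDomain (z + z') where
  u_mem := h.u_mem.add h'.u_mem
  v_mem := Submodule.add_mem _ h.v_mem h'.v_mem
  w_mem := Submodule.add_mem _ h.w_mem h'.w_mem
  η_mem := Submodule.add_mem _ h.η_mem h'.η_mem
  φ_mem := by rw [StateSpace.φ_add]; exact h.φ_mem.add h'.φ_mem
  flux := by
    obtain ⟨y, a, b⟩ := h.flux
    obtain ⟨y', a', b'⟩ := h'.flux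
    rw [StateSpace.u_add, StateSpace.φ_add, wderiv_add h.u_mem.1 h'.u_mem.1,
      wderiv_add h.φ_mem.1 h'.φ_mem.1]
    exact ⟨_, a.add a', b.add b'⟩
  velocity := by
    obtain ⟨y, a, b⟩ := h.velocity
    obtain ⟨y', a', b'⟩ := h'.velocity
    exact ⟨_, a.add a', b.add b'⟩

lemma InDomain.smul (c : ℂ) {z : k.StateSpace} (h : InDomain z) : InDomain (c • z) where
  u_mem := h.u_mem.smul c
  v_mem := Submodule.smul_mem _ c h.v_mem
  w_mem := Submodule.smul_mem _ c h.w_mem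
  η_mem := Submodule.smul_mem _ c h.η_mem
  φ_mem := by rw [StateSpace.φ_smul]; exact h.φ_mem.smul c
  flux := by
    obtain ⟨y, a, b⟩ := h.flux
    rw [StateSpace.u_smul, StateSpace.φ_smul, wderiv_smul c h.u_mem.1, wderiv_smul c h.φ_mem.1]
    exact ⟨_, a.smul c, b.smul c⟩
  velocity := by
    obtain ⟨y, a, b⟩ := h.velocity
    exact ⟨_, a.smul c, b.smul c⟩

/-- The state `(u, v, w, η)` with given components. -/
noncomputable def StateSpace.mk (u : H1l) (v : L2 (-1) 0) (w : L2 0 1) (η : k.M) : k.StateSpace :=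
  WithLp.toLp 2 (u, WithLp.toLp 2 (v, WithLp.toLp 2 (w, η)))

lemma StateSpace.mk_add (u u' : H1l) (v v' : L2 (-1) 0) (w w' : L2 0 1) (η η' : k.M) :
    StateSpace.mk (u + u') (v + v') (w + w') (η + η') =
      StateSpace.mk u v w η + StateSpace.mk u' v' w' η' := rfl

lemma StateSpace.mk_smul (c : ℂ) (u : H1l) (v : L2 (-1) 0) (w : L2 0 1) (η : k.M) :
    StateSpace.mk (c • u) (c • v) (c • w) (c • η) = c • StateSpace.mk u v w η := rfl

/-- The value `𝔸 z = (v, u'', φ'', T η + w)` for `z = (u, v, w, η)` in the domain; in the last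
component `w` stands for the function of `s` with the constant value `w ∈ H¹_r(0, 1)`. -/
noncomputable def systemValue (z : k.StateSpace) (h : InDomain z) : k.StateSpace :=
  StateSpace.mk (H1V.mk (StateSpace.v z) h.v_mem)
    (wderiv (wderiv (H1V.toL2 (StateSpace.u z))))
    (wderiv (wderiv (StateSpace.φ z)))
    (k.T ⟨StateSpace.η z, h.η_mem⟩ +
      Lp.constL 2 k.measure ℂ (H1V.mk (StateSpace.w z) h.w_mem : H1r))

lemma systemValue_add {z z' : k.StateSpace} (h : InDomain z) (h' : InDomain z') :
    systemValue (z + z') (h.add h') = systemValue z h + systemValue z' h' := by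
  rw [systemValue, systemValue, systemValue, ← StateSpace.mk_add]
  congr 1
  · rw [StateSpace.u_add, wderiv_add h.u_mem.1 h'.u_mem.1, wderiv_add h.u_mem.2 h'.u_mem.2]
  · rw [StateSpace.φ_add, wderiv_add h.φ_mem.1 h'.φ_mem.1, wderiv_add h.φ_mem.2 h'.φ_mem.2]
  · rw [add_add_add_comm, ← map_add, ← LinearPMap.map_add]
    rfl

lemma systemValue_smul (c : ℂ) {z : k.StateSpace} (h : InDomain z) :
    systemValue (c • z) (h.smul c) = c • systemValue z h := by
  rw [systemValue, systemValue, ← StateSpace.mk_smul]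
  congr 1
  · rw [StateSpace.u_smul, wderiv_smul c h.u_mem.1, wderiv_smul c h.u_mem.2]
  · rw [StateSpace.φ_smul, wderiv_smul c h.φ_mem.1, wderiv_smul c h.φ_mem.2]
  · rw [smul_add, ← map_smul, ← LinearPMap.map_smul]
    rfl

variable (k)

/-- The system operator `𝔸 : D(𝔸) ⊆ ℋ → ℋ`. -/
noncomputable def systemOp : k.StateSpace →ₗ.[ℂ] k.StateSpace where
  domain :=
    { carrier := {z | InDomain z}
      zero_mem' := InDomain.zero
      add_mem' := InDomain.add
      smul_mem' := fun c _ => InDomain.smul c }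
  toFun :=
    { toFun := fun z => systemValue z.1 z.2
      map_add' := fun z z' => systemValue_add z.2 z'.2
      map_smul' := fun c z => systemValue_smul c z.2 }

end MemoryKernel
end Memory

section Resolvent

variable {X : Type*} [NormedAddCommGroup X] [NormedSpace ℂ X]

/-- The bounded operator `R` is the inverse of `ζ - A : D(A) → X`. -/
structure IsResolventAt (A : X →ₗ.[ℂ] X) (ζ : ℂ) (R : X →L[ℂ] X) : Prop where
  mem : ∀ x, R x ∈ A.domain
  right_inv : ∀ x, ζ • R x - A ⟨R x, mem x⟩ = x
  left_inv : ∀ z : A.domain, R (ζ • (z : X) - A z) = z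

/-- The resolvent set `ρ(A)` of an unbounded operator. -/
def resolventSetOf (A : X →ₗ.[ℂ] X) : Set ℂ := {ζ | ∃ R, IsResolventAt A ζ R}

/-- The spectrum `σ(A)` of an unbounded operator. -/
def spectrumOf (A : X →ₗ.[ℂ] X) : Set ℂ := (resolventSetOf A)ᶜ

open Classical in
/-- The resolvent operator `R(ζ, A) = (ζ - A)⁻¹` for `ζ ∈ ρ(A)` (and `0` for `ζ ∉ ρ(A)`). -/
noncomputable def resolventOf (A : X →ₗ.[ℂ] X) (ζ : ℂ) : X →L[ℂ] X :=
  if h : ∃ R, IsResolventAt A ζ R then h.choose else 0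

end Resolvent

end WaveCG

/-!
The resolvent is bounded below by approximate eigenvectors: if `‖(iτ - 𝔸) z‖ ≤ C τ^{-1/2} ‖z‖` with
`z ≠ 0` and `iτ ∈ ρ(𝔸)`, then `‖R(iτ, 𝔸)‖ ≥ τ^{1/2} / C`. Such `z` exist for all large `τ ∈ 2πℕ`
(`MemoryKernel.exists_approx_eigenvector`).

At high frequency the memory law is a small perturbation of heat conduction: with
`η(s) = (1 - e^{-iτs}) / (iτ) w` the last component of `(iτ - 𝔸) z` vanishes and `φ = (1 + κ) w`
with `κ = O(1/τ)`. A heat boundary layer `w ≈ e^{-lx} / l`, `l = √(iτ)`, carries a flux of order one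
through the interface although `w(0)` has size `τ^{-1/2}` only. The wave
`u = (c/τ) sin (τ(x+1))`, `v = iτ u`, has a node at the interface when `τ ∈ 2πℕ`, so it matches the
layer up to an error of order `τ^{-1/2}` in `v(0)`. The correction `a (x+1) cos (τ(x+1))` to `u`, with
`a = O(τ^{-3/2})`, removes this error and leaves a residual `2 a τ sin (τ(x+1))` in the wave
equation. The residual in the heat equation consists of `κ w''` and of the exponentially small
constant that enforces `w(1) = 0`. All residuals are `O(τ^{-1/2})` already in the supremum norm, while
`‖v‖ ≥ 1/4`. That states of this form lie in the domain is `MemoryKernel.exists_state`.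
-/

namespace WaveCG

/-! ### Classical derivatives as weak derivatives -/

lemma hasWeakDeriv_of_hasDerivAt {E : Type*} [NormedAddCommGroup E] [NormedSpace ℂ E]
    {U : Set ℝ} (hU : IsOpen U) {f g : ℝ → E} (hg : Continuous g)
    (h : ∀ x, HasDerivAt f (g x) x) : HasWeakDeriv U f g := by
  have hf : Continuous f := continuous_iff_continuousAt.2 fun x => (h x).continuousAt
  refine ⟨hf.continuousOn.locallyIntegrableOn hU.measurableSet,
    hg.continuousOn.locallyIntegrableOn hU.measurableSet, fun ψ h1 h2 h3 => ?_⟩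
  have dc : Continuous (deriv ψ) := h1.continuous_deriv (by simp)
  have extend : ∀ (χ : ℝ → ℝ) (F : ℝ → E), tsupport χ ⊆ U →
      ∫ x in U, χ x • F x = ∫ x, χ x • F x := fun χ F hχ =>
    setIntegral_eq_integral_of_forall_compl_eq_zero fun x hx => by
      rw [image_eq_zero_of_notMem_tsupport fun hh => hx (hχ hh), zero_smul]
  rw [extend _ _ (tsupport_deriv_subset'.trans h3), extend _ _ h3]
  have i1 : Integrable fun x => deriv ψ x • f x :=
    (dc.smul hf).integrable_of_hasCompactSupport h2.deriv.smul_right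
  have i2 : Integrable fun x => ψ x • g x :=
    (h1.continuous.smul hg).integrable_of_hasCompactSupport h2.smul_right
  have i3 : Integrable fun x => ψ x • f x :=
    (h1.continuous.smul hf).integrable_of_hasCompactSupport h2.smul_right
  have key := integral_eq_zero_of_hasDerivAt_of_integrable
    (fun x => ((h1.differentiable (by simp) x).hasDerivAt).smul (h x)) (i2.add i1) i3
  rw [integral_add i2 i1] at key
  exact (neg_eq_of_add_eq_zero_right key).symm

/-! ### Continuous functions as elements of `L²(a, b)` -/

lemma memLp_of_continuous {a b : ℝ} {F : ℝ → ℂ} (hF : Continuous F) :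
    MemLp F 2 (volume.restrict (Ioo a b)) := by
  obtain ⟨C, hC⟩ := (isCompact_Icc (a := a) (b := b)).exists_bound_of_continuousOn hF.continuousOn
  refine MemLp.of_bound hF.aestronglyMeasurable C ?_
  filter_upwards [ae_restrict_mem measurableSet_Ioo] with x hx using hC x (Ioo_subset_Icc_self hx)

/-- The class in `L²(a, b)` of a continuous function on the real line. -/
noncomputable def contL2 (a b : ℝ) : C(ℝ, ℂ) →ₗ[ℂ] L2 a b where
  toFun F := (memLp_of_continuous F.continuous).toLp F
  map_add' F G := MemLp.toLp_add (memLp_of_continuous F.continuous)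
    (memLp_of_continuous G.continuous)
  map_smul' c F := MemLp.toLp_const_smul c (memLp_of_continuous F.continuous)

lemma coeFn_contL2 {a b : ℝ} (F : C(ℝ, ℂ)) :
    contL2 a b F =ᵐ[volume.restrict (Ioo a b)] F :=
  (memLp_of_continuous F.continuous).coeFn_toLp

lemma hasWeakDeriv_contL2 {a b : ℝ} {F G : C(ℝ, ℂ)} (h : ∀ x, HasDerivAt F (G x) x) :
    HasWeakDeriv (Ioo a b) (contL2 a b F) (contL2 a b G) :=
  (hasWeakDeriv_of_hasDerivAt isOpen_Ioo G.continuous h).congr (coeFn_contL2 F).symm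
    (coeFn_contL2 G).symm

lemma wderiv_contL2 {a b : ℝ} {F G : C(ℝ, ℂ)} (h : ∀ x, HasDerivAt F (G x) x) :
    wderiv (contL2 a b F) = contL2 a b G := wderiv_eq (hasWeakDeriv_contL2 h)

lemma isH1_contL2 {a b : ℝ} {F G : C(ℝ, ℂ)} (h : ∀ x, HasDerivAt F (G x) x) :
    IsH1 (contL2 a b F) := ⟨_, hasWeakDeriv_contL2 h⟩

lemma isH2_contL2 {a b : ℝ} {F G H : C(ℝ, ℂ)} (h : ∀ x, HasDerivAt F (G x) x)
    (h' : ∀ x, HasDerivAt G (H x) x) : IsH2 (contL2 a b F) :=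
  ⟨isH1_contL2 h, by rw [wderiv_contL2 h]; exact isH1_contL2 h'⟩

lemma hasValueAt_contL2 {a b : ℝ} (F : C(ℝ, ℂ)) (c : ℝ) : HasValueAt (contL2 a b F) c (F c) :=
  ⟨F, F.continuous.continuousOn, coeFn_contL2 F, rfl⟩

lemma contL2_mem_h1Vanish {a b c : ℝ} {F G : C(ℝ, ℂ)} (h : ∀ x, HasDerivAt F (G x) x)
    (hc : F c = 0) : contL2 a b F ∈ h1Vanish a b c :=
  ⟨isH1_contL2 h, hc ▸ hasValueAt_contL2 F c⟩

lemma norm_contL2_sq {a b : ℝ} (F : C(ℝ, ℂ)) :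
    ‖contL2 a b F‖ ^ 2 = ∫ x in Ioo a b, ‖F x‖ ^ 2 := by
  rw [@norm_sq_eq_re_inner ℂ, L2.inner_def, ← integral_re (L2.integrable_inner _ _)]
  refine integral_congr_ae ?_
  filter_upwards [coeFn_contL2 F] with x hx
  rw [hx, ← norm_sq_eq_re_inner]

lemma norm_contL2_le {a b : ℝ} (hab : b = a + 1) (F : C(ℝ, ℂ)) {C : ℝ} (hC : 0 ≤ C)
    (h : ∀ x ∈ Ioo a b, ‖F x‖ ≤ C) : ‖contL2 a b F‖ ≤ C := by
  refine le_of_sq_le_sq ?_ hC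
  rw [norm_contL2_sq]
  have h1 : ‖∫ x in Ioo a b, ‖F x‖ ^ 2‖ ≤ C ^ 2 * volume.real (Ioo a b) :=
    norm_setIntegral_le_of_norm_le_const (by simp) fun x hx => by
      rw [Real.norm_of_nonneg (by positivity)]
      exact pow_le_pow_left₀ (norm_nonneg _) (h x hx) 2
  have h2 : volume.real (Ioo a b) = 1 := by
    rw [Real.volume_real_Ioo_of_le (by linarith)]; linarith
  rw [h2, mul_one] at h1
  exact (le_abs_self _).trans h1

/-! ### The memory variable at frequency `τ` -/

namespace MemoryKernel

variable (k : MemoryKernel)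

/-- The scalar profile `s ↦ (1 - e^{-iτs}) / (iτ)`: the solution of `iτ η + η_s = 1` with
`η(0) = 0`. -/
noncomputable def profile (τ s : ℝ) : ℂ :=
  (1 - Complex.exp (-(Complex.I * τ * s))) / (Complex.I * τ)

lemma norm_exp_neg_I_mul (τ s : ℝ) : ‖Complex.exp (-(Complex.I * τ * s))‖ = 1 := by
  rw [show -(Complex.I * τ * s) = ((-(τ * s) : ℝ) : ℂ) * Complex.I by push_cast; ring,
    Complex.norm_exp_ofReal_mul_I]

lemma continuous_profile (τ : ℝ) : Continuous (profile τ) := by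
  unfold profile; fun_prop

lemma norm_profile_le {τ : ℝ} (hτ : 0 < τ) (s : ℝ) : ‖profile τ s‖ ≤ 2 / τ := by
  rw [profile, norm_div, norm_mul, Complex.norm_I, one_mul, Complex.norm_of_nonneg hτ.le]
  gcongr
  refine (norm_sub_le _ _).trans ?_
  rw [norm_exp_neg_I_mul, norm_one]; norm_num

lemma hasDerivAt_profile {τ : ℝ} (hτ : 0 < τ) (s : ℝ) :
    HasDerivAt (profile τ) (Complex.exp (-(Complex.I * τ * s))) s := by
  have hne : Complex.I * (τ : ℂ) ≠ 0 := mul_ne_zero Complex.I_ne_zero (by exact_mod_cast hτ.ne')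
  have h1 : HasDerivAt (fun s : ℝ => -(Complex.I * τ * (s : ℂ))) (-(Complex.I * τ)) s := by
    simpa using ((Complex.ofRealCLM.hasDerivAt (x := s)).const_mul (Complex.I * τ)).fun_neg
  refine ((h1.cexp.const_sub 1).div_const (Complex.I * τ)).congr_deriv ?_
  rw [div_eq_iff hne]; ring

/-- The integral `κ(τ) = ∫ μ(s) (1 - e^{-iτs}) / (iτ) ds`: at frequency `τ` one has
`φ = (1 + κ(τ)) w`. -/
noncomputable def kappa (τ : ℝ) : ℂ := ∫ s, profile τ s ∂k.measure

lemma norm_kappa_le {τ : ℝ} (hτ : 0 < τ) : ‖k.kappa τ‖ ≤ 2 / τ * k.measure.real univ :=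
  norm_integral_le_of_norm_le_const (ae_of_all _ (norm_profile_le hτ))

lemma memLp_smul {c : ℝ → ℂ} (hc : Continuous c) {C : ℝ} (hC : ∀ s, ‖c s‖ ≤ C) (W : H1r) :
    MemLp (fun s => c s • W) 2 k.measure :=
  .of_bound (hc.smul continuous_const).aestronglyMeasurable (C * ‖W‖) <| ae_of_all _ fun s => by
    rw [norm_smul]; exact mul_le_mul_of_nonneg_right (hC s) (norm_nonneg _)

/-- The memory variable `η(s) = (1 - e^{-iτs}) / (iτ) W` belonging to `W ∈ H¹_r(0, 1)`. -/
noncomputable def history {τ : ℝ} (hτ : 0 < τ) (W : H1r) : k.M :=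
  (k.memLp_smul (continuous_profile τ) (norm_profile_le hτ) W).toLp

lemma coeFn_history {τ : ℝ} (hτ : 0 < τ) (W : H1r) :
    k.history hτ W =ᵐ[k.measure] fun s => profile τ s • W := MemLp.coeFn_toLp _

lemma integral_history {τ : ℝ} (hτ : 0 < τ) (W : H1r) :
    ∫ s, k.history hτ W s ∂k.measure = k.kappa τ • W := by
  rw [integral_congr_ae (k.coeFn_history hτ W), kappa, integral_smul_const]

/-- The weak derivative `η_s = e^{-iτs} W` of `MemoryKernel.history`. -/
noncomputable def historyDeriv (τ : ℝ) (W : H1r) : k.M :=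
  (k.memLp_smul (c := fun s : ℝ => Complex.exp (-(Complex.I * τ * s))) (by fun_prop)
    (fun s => (norm_exp_neg_I_mul τ s).le) W).toLp

lemma coeFn_historyDeriv (τ : ℝ) (W : H1r) :
    k.historyDeriv τ W =ᵐ[k.measure] fun s : ℝ => Complex.exp (-(Complex.I * τ * s)) • W :=
  MemLp.coeFn_toLp _

lemma hasWeakDeriv_history {τ : ℝ} (hτ : 0 < τ) (W : H1r) :
    HasWeakDeriv k.posSet (k.history hτ W) (k.historyDeriv τ W) :=
  (hasWeakDeriv_of_hasDerivAt k.isOpen_posSet (by fun_prop)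
    fun s => (hasDerivAt_profile hτ s).smul_const W).congr
      (k.ae_measure_iff.1 (k.coeFn_history hτ W).symm)
      (k.ae_measure_iff.1 (k.coeFn_historyDeriv τ W).symm)

lemma history_mem_domain {τ : ℝ} (hτ : 0 < τ) (W : H1r) : k.history hτ W ∈ k.T.domain := by
  have hc : Continuous fun s => profile τ s • W := (continuous_profile τ).smul continuous_const
  refine ⟨⟨_, k.hasWeakDeriv_history hτ W⟩, _, hc.continuousOn, k.coeFn_history hτ W, ?_⟩
  have h := (hc.norm.tendsto 0).mono_left (nhdsWithin_le_nhds (s := Ioi 0))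
  simpa [profile] using h

lemma smul_history_sub {τ : ℝ} (hτ : 0 < τ) (W : H1r) :
    (Complex.I * τ) • k.history hτ W -
      (k.T ⟨k.history hτ W, k.history_mem_domain hτ W⟩ + Lp.constL 2 k.measure ℂ W) = 0 := by
  have hne : Complex.I * (τ : ℂ) ≠ 0 := mul_ne_zero Complex.I_ne_zero (by exact_mod_cast hτ.ne')
  have hT : k.T ⟨k.history hτ W, k.history_mem_domain hτ W⟩ = -k.historyDeriv τ W := by
    change -k.memDeriv (k.history hτ W) = _
    rw [memDeriv_eq (k.hasWeakDeriv_history hτ W)]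
  rw [hT, sub_eq_zero, eq_neg_add_iff_add_eq, Lp.constL_apply]
  refine Lp.ext ?_
  filter_upwards [Lp.coeFn_add (k.historyDeriv τ W) ((Complex.I * τ) • k.history hτ W),
    Lp.coeFn_smul (Complex.I * (τ : ℂ)) (k.history hτ W), k.coeFn_history hτ W,
    k.coeFn_historyDeriv τ W, Lp.coeFn_const 2 k.measure W] with s h1 h2 h3 h4 h5
  rw [h1, h5, Pi.add_apply, h2, Pi.smul_apply, h3, h4, smul_smul, ← add_smul, profile,
    mul_div_cancel₀ _ hne, add_sub_cancel, one_smul]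
  rfl

end MemoryKernel

/-! ### States at frequency `τ` -/

namespace MemoryKernel

variable (k : MemoryKernel)

/-- A state built from classical functions `u` and `w` with `v = iτ u` and `η` the history of `w` at
frequency `τ`: the first and the last component of `(iτ - 𝔸) z` vanish. -/
lemma exists_state {τ : ℝ} (hτ : 0 < τ) {u u' u'' w w' w'' : C(ℝ, ℂ)}
    (hu : ∀ x, HasDerivAt u (u' x) x) (hu' : ∀ x, HasDerivAt u' (u'' x) x)
    (hw : ∀ x, HasDerivAt w (w' x) x) (hw' : ∀ x, HasDerivAt w' (w'' x) x)
    (u_bd : u (-1) = 0) (w_bd : w 1 = 0) (flux : u' 0 = (1 + k.kappa τ) * w' 0)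
    (velocity : Complex.I * τ * u 0 = w 0) :
    ∃ z : k.systemOp.domain,
      StateSpace.v (z : k.StateSpace) = contL2 (-1) 0 ((Complex.I * τ) • u) ∧
      (Complex.I * τ) • (z : k.StateSpace) - k.systemOp z =
        StateSpace.mk 0 (contL2 (-1) 0 ((Complex.I * τ) • (Complex.I * τ) • u - u''))
          (contL2 0 1 ((Complex.I * τ) • w - (1 + k.kappa τ) • w'')) 0 := by
  have hv : ∀ x, HasDerivAt ((Complex.I * (τ : ℂ)) • u)
      (((Complex.I * (τ : ℂ)) • u') x) x := fun x => (hu x).const_smul _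
  have hφ : ∀ x, HasDerivAt ((1 + k.kappa τ) • w) (((1 + k.kappa τ) • w') x) x :=
    fun x => (hw x).const_smul _
  have hφ' : ∀ x, HasDerivAt ((1 + k.kappa τ) • w') (((1 + k.kappa τ) • w'') x) x :=
    fun x => (hw' x).const_smul _
  set U : H1l := H1V.mk (contL2 (-1) 0 u) (contL2_mem_h1Vanish hu u_bd) with hU
  set W : H1r := H1V.mk (contL2 0 1 w) (contL2_mem_h1Vanish hw w_bd) with hW
  set z : k.StateSpace := StateSpace.mk U (contL2 (-1) 0 ((Complex.I * τ) • u)) (contL2 0 1 w)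
    (k.history hτ W) with hz
  have zu : H1V.toL2 (StateSpace.u z) = contL2 (-1) 0 u := rfl
  have zφ : StateSpace.φ z = contL2 0 1 ((1 + k.kappa τ) • w) := by
    change contL2 0 1 w + H1V.toL2 (∫ s, k.history hτ W s ∂k.measure) = _
    rw [k.integral_history, map_smul, map_smul, add_smul, one_smul]
    rfl
  have zD : InDomain z :=
    { u_mem := by rw [zu]; exact isH2_contL2 hu hu'
      v_mem := contL2_mem_h1Vanish hv (by simp [u_bd])
      w_mem := contL2_mem_h1Vanish hw w_bd
      η_mem := k.history_mem_domain hτ W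
      φ_mem := by rw [zφ]; exact isH2_contL2 hφ hφ'
      flux := by
        rw [zu, zφ, wderiv_contL2 hu, wderiv_contL2 hφ]
        exact ⟨_, hasValueAt_contL2 u' 0, by
          rw [flux]; exact hasValueAt_contL2 ((1 + k.kappa τ) • w') 0⟩
      velocity := by
        refine ⟨_, hasValueAt_contL2 _ 0, ?_⟩
        simp only [ContinuousMap.smul_apply, smul_eq_mul, velocity]
        exact hasValueAt_contL2 w 0 }
  refine ⟨⟨z, zD⟩, rfl, ?_⟩
  have e1 : (Complex.I * (τ : ℂ)) • U - H1V.mk (StateSpace.v z) zD.v_mem = 0 :=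
    sub_eq_zero.2 (Subtype.ext (map_smul (contL2 (-1) 0) _ u).symm)
  have e2 : (Complex.I * (τ : ℂ)) • StateSpace.v z - wderiv (wderiv (H1V.toL2 (StateSpace.u z))) =
      contL2 (-1) 0 ((Complex.I * τ) • (Complex.I * τ) • u - u'') := by
    rw [zu, wderiv_contL2 hu, wderiv_contL2 hu', map_sub, map_smul]; rfl
  have e3 : (Complex.I * (τ : ℂ)) • StateSpace.w z - wderiv (wderiv (StateSpace.φ z)) =
      contL2 0 1 ((Complex.I * τ) • w - (1 + k.kappa τ) • w'') := by
    rw [zφ, wderiv_contL2 hφ, wderiv_contL2 hφ', map_sub, map_smul]; rfl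
  rw [← e1, ← e2, ← e3, ← k.smul_history_sub hτ W]
  rfl

variable {k}

lemma norm_v_le (z : k.StateSpace) : ‖StateSpace.v z‖ ≤ ‖z‖ :=
  (WithLp.norm_fst_le _ _).trans (WithLp.norm_snd_le _ _)

lemma norm_mk_zero_zero_le (f : L2 (-1) 0) (g : L2 0 1) :
    ‖(StateSpace.mk 0 f g 0 : k.StateSpace)‖ ≤ ‖f‖ + ‖g‖ := by
  have h : ‖(StateSpace.mk 0 f g 0 : k.StateSpace)‖ ^ 2 = ‖f‖ ^ 2 + ‖g‖ ^ 2 := by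
    rw [WithLp.prod_norm_sq_eq_of_L2, WithLp.prod_norm_sq_eq_of_L2, WithLp.prod_norm_sq_eq_of_L2]
    simp [StateSpace.mk]
  refine le_of_sq_le_sq ?_ (by positivity)
  rw [h]
  nlinarith [norm_nonneg f, norm_nonneg g]

end MemoryKernel

/-! ### Lower bounds for the resolvent -/

lemma isResolventAt_resolventOf {X : Type*} [NormedAddCommGroup X] [NormedSpace ℂ X]
    {A : X →ₗ.[ℂ] X} {ζ : ℂ} (h : ζ ∈ resolventSetOf A) : IsResolventAt A ζ (resolventOf A ζ) := by
  have h' : ∃ R, IsResolventAt A ζ R := h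
  rw [resolventOf, dif_pos h']; exact h'.choose_spec

/-- An approximate eigenvector bounds the resolvent from below. -/
lemma norm_le_norm_resolventOf_mul {X : Type*} [NormedAddCommGroup X] [NormedSpace ℂ X]
    {A : X →ₗ.[ℂ] X} {ζ : ℂ} (h : ζ ∈ resolventSetOf A) (z : A.domain) :
    ‖(z : X)‖ ≤ ‖resolventOf A ζ‖ * ‖ζ • (z : X) - A z‖ := by
  conv_lhs => rw [← (isResolventAt_resolventOf h).left_inv z]
  exact (resolventOf A ζ).le_opNorm _

/-! ### Trigonometric and exponential building blocks -/

/-- `x ↦ sin (τ (x + 1))`. -/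
noncomputable def sinWave (τ : ℝ) : C(ℝ, ℂ) := ⟨fun x => (Real.sin (τ * (x + 1)) : ℝ), by fun_prop⟩

/-- `x ↦ cos (τ (x + 1))`. -/
noncomputable def cosWave (τ : ℝ) : C(ℝ, ℂ) := ⟨fun x => (Real.cos (τ * (x + 1)) : ℝ), by fun_prop⟩

/-- The affine function `x ↦ x + 1`. -/
noncomputable def ramp : C(ℝ, ℂ) := ⟨fun x => (x : ℂ) + 1, by fun_prop⟩

/-- `x ↦ e^{-lx}`. -/
noncomputable def expDecay (l : ℂ) : C(ℝ, ℂ) := ⟨fun x => Complex.exp (-(l * x)), by fun_prop⟩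

lemma hasDerivAt_sinWave (τ x : ℝ) : HasDerivAt (sinWave τ) (((τ : ℂ) • cosWave τ) x) x := by
  have h : HasDerivAt (fun x : ℝ => Real.sin (τ * (x + 1))) (Real.cos (τ * (x + 1)) * (τ * 1)) x :=
    (((hasDerivAt_id x).add_const 1).const_mul τ).sin
  refine h.ofReal_comp.congr_deriv ?_
  simp [cosWave, mul_comm]

lemma hasDerivAt_cosWave (τ x : ℝ) : HasDerivAt (cosWave τ) ((-(τ : ℂ) • sinWave τ) x) x := by
  have h : HasDerivAt (fun x : ℝ => Real.cos (τ * (x + 1))) (-Real.sin (τ * (x + 1)) * (τ * 1)) x :=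
    (((hasDerivAt_id x).add_const 1).const_mul τ).cos
  refine h.ofReal_comp.congr_deriv ?_
  simp [sinWave, mul_comm]

lemma hasDerivAt_ramp (x : ℝ) : HasDerivAt ramp ((1 : C(ℝ, ℂ)) x) x :=
  Complex.ofRealCLM.hasDerivAt.add_const 1

lemma hasDerivAt_expDecay (l : ℂ) (x : ℝ) :
    HasDerivAt (expDecay l) ((-l • expDecay l) x) x := by
  have h : HasDerivAt (fun x : ℝ => -(l * (x : ℂ))) (-l) x := by
    simpa using ((Complex.ofRealCLM.hasDerivAt (x := x)).const_mul l).fun_neg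
  exact h.cexp.congr_deriv (mul_comm _ _)

lemma sinWave_zero (τ : ℝ) : sinWave τ 0 = Real.sin τ := by
  change ((Real.sin (τ * (0 + 1)) : ℝ) : ℂ) = _
  rw [zero_add, mul_one]

lemma cosWave_zero (τ : ℝ) : cosWave τ 0 = Real.cos τ := by
  change ((Real.cos (τ * (0 + 1)) : ℝ) : ℂ) = _
  rw [zero_add, mul_one]

lemma norm_sinWave_le (τ x : ℝ) : ‖sinWave τ x‖ ≤ 1 := by
  change ‖((Real.sin (τ * (x + 1)) : ℝ) : ℂ)‖ ≤ 1
  rw [Complex.norm_real]; exact Real.abs_sin_le_one _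

lemma norm_cosWave_le (τ x : ℝ) : ‖cosWave τ x‖ ≤ 1 := by
  change ‖((Real.cos (τ * (x + 1)) : ℝ) : ℂ)‖ ≤ 1
  rw [Complex.norm_real]; exact Real.abs_cos_le_one _

lemma norm_ramp_le {x : ℝ} (hx : x ∈ Ioo (-1) 0) : ‖ramp x‖ ≤ 1 := by
  change ‖(x : ℂ) + 1‖ ≤ 1
  rw [show (x : ℂ) + 1 = ((x + 1 : ℝ) : ℂ) by push_cast; rfl, Complex.norm_real, Real.norm_eq_abs,
    abs_le]
  constructor <;> linarith [hx.1, hx.2]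

lemma norm_expDecay (l : ℂ) (x : ℝ) : ‖expDecay l x‖ = Real.exp (-(l.re * x)) := by
  change ‖Complex.exp (-(l * x))‖ = _
  simp [Complex.norm_exp]

lemma norm_sq_contL2_sinWave {τ : ℝ} (hτ : τ ≠ 0) (hs : Real.sin τ = 0) :
    ‖contL2 (-1) 0 (sinWave τ)‖ ^ 2 = 1 / 2 := by
  have h : ∀ x : ℝ, ‖sinWave τ x‖ ^ 2 = Real.sin (τ * x + τ) ^ 2 := fun x => by
    change ‖((Real.sin (τ * (x + 1)) : ℝ) : ℂ)‖ ^ 2 = _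
    rw [Complex.norm_real, Real.norm_eq_abs, sq_abs, mul_add, mul_one]
  rw [norm_contL2_sq, ← integral_Ioc_eq_integral_Ioo,
    ← intervalIntegral.integral_of_le (by norm_num)]
  simp_rw [h]
  rw [intervalIntegral.integral_comp_mul_add (fun x => Real.sin x ^ 2) hτ τ, integral_sin_sq]
  simp [hs]
  field_simp

/-! ### Approximate eigenvectors -/

/-- The decay rate `l = √(iτ)` of the heat component. -/
noncomputable def decayRate (τ : ℝ) : ℂ := (√(τ / 2) : ℝ) * (1 + Complex.I)

lemma decayRate_sq {τ : ℝ} (hτ : 0 < τ) : decayRate τ * decayRate τ = Complex.I * τ := by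
  have h : ((√(τ / 2) : ℝ) : ℂ) * (√(τ / 2) : ℝ) = τ / 2 := by
    rw [← Complex.ofReal_mul, Real.mul_self_sqrt (by positivity)]; push_cast; rfl
  calc decayRate τ * decayRate τ
      = ((√(τ / 2) : ℝ) : ℂ) * (√(τ / 2) : ℝ) * (1 + 2 * Complex.I + Complex.I ^ 2) := by
        unfold decayRate; ring
    _ = Complex.I * τ := by rw [h, Complex.I_sq]; ring

lemma norm_decayRate {τ : ℝ} (hτ : 0 < τ) : ‖decayRate τ‖ = √τ := by
  rw [eq_comm, Real.sqrt_eq_iff_mul_self_eq hτ.le (norm_nonneg _), ← norm_mul, decayRate_sq hτ]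
  simp [abs_of_pos hτ]

lemma norm_expDecay_decayRate_one_le {τ : ℝ} (hτ : 0 < τ) :
    ‖expDecay (decayRate τ) 1‖ ≤ 4 / τ := by
  have hre : (decayRate τ).re = √(τ / 2) := by simp [decayRate]
  have hsq : √(τ / 2) ^ 2 = τ / 2 := Real.sq_sqrt (by positivity)
  have hexp := Real.quadratic_le_exp_of_nonneg (Real.sqrt_nonneg (τ / 2))
  rw [norm_expDecay, hre, mul_one, Real.exp_neg, ← one_div, div_le_div_iff₀ (Real.exp_pos _) hτ]
  linarith [Real.sqrt_nonneg (τ / 2)]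

lemma norm_expDecay_decayRate_le (τ : ℝ) {x : ℝ} (hx : 0 ≤ x) :
    ‖expDecay (decayRate τ) x‖ ≤ 1 := by
  have hre : (decayRate τ).re = √(τ / 2) := by simp [decayRate]
  rw [norm_expDecay, hre, Real.exp_le_one_iff]
  have := mul_nonneg (Real.sqrt_nonneg (τ / 2)) hx
  linarith

lemma expDecay_zero (l : ℂ) : expDecay l 0 = 1 := by simp [expDecay]

/-- At frequencies `τ ∈ 2πℕ` the wave with a node at the interface is an approximate eigenvector,
with an error of order `τ^{-1/2}` caused by the heat component that carries the flux `u'(0)`. -/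
lemma MemoryKernel.exists_approx_eigenvector (k : MemoryKernel) {τ : ℝ} (hsin : Real.sin τ = 0)
    (hcos : Real.cos τ = 1) (hτ : 400 + 8 * k.measure.real univ ≤ τ) :
    ∃ z : k.systemOp.domain, 1 / 4 ≤ ‖(z : k.StateSpace)‖ ∧
      ‖(Complex.I * τ) • (z : k.StateSpace) - k.systemOp z‖ ≤
        (8 + 2 * k.measure.real univ) / √τ := by
  set m := k.measure.real univ with hm
  have m0 : 0 ≤ m := measureReal_nonneg
  have τ0 : 0 < τ := by linarith
  have τC : (τ : ℂ) ≠ 0 := by exact_mod_cast τ0.ne'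
  set l := decayRate τ with hl
  have ll : l * l = Complex.I * τ := decayRate_sq τ0
  have nl : ‖l‖ = √τ := norm_decayRate τ0
  have q20 : 20 ≤ √τ := Real.le_sqrt_of_sq_le (by linarith)
  have q0 : 0 < √τ := by linarith
  have qq : √τ * √τ = τ := Real.mul_self_sqrt τ0.le
  have l0 : l ≠ 0 := by rw [← norm_pos_iff, nl]; exact q0
  set ε : ℂ := expDecay l 1 with hε
  have nε : ‖ε‖ ≤ 4 / τ := norm_expDecay_decayRate_one_le τ0
  have nε' : ‖ε‖ ≤ 1 := norm_expDecay_decayRate_le τ zero_le_one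
  have nκ : ‖k.kappa τ‖ ≤ 2 / τ * m := k.norm_kappa_le τ0
  -- `a` is fixed by `v(0) = w(0)`, and `c` by `u'(0) = φ'(0) = -(1 + κ)`.
  set a : ℂ := (1 - ε) / (Complex.I * τ * l) with ha
  set c : ℂ := -(1 + k.kappa τ) - a with hc
  have a_le : τ * ‖a‖ ≤ 2 / √τ := by
    rw [ha, norm_div, norm_mul, norm_mul, Complex.norm_I, one_mul, Complex.norm_of_nonneg τ0.le, nl,
      show τ * (‖1 - ε‖ / (τ * √τ)) = ‖1 - ε‖ / √τ by field_simp]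
    gcongr
    exact (norm_sub_le _ _).trans (by rw [norm_one]; linarith)
  have a_small : τ * ‖a‖ ≤ 1 / 10 := a_le.trans (by rw [div_le_iff₀ q0]; linarith)
  have c_ge : 1 / 2 ≤ ‖c‖ := by
    have h1 : ‖k.kappa τ‖ ≤ 1 / 4 := nκ.trans (by
      rw [div_mul_eq_mul_div, div_le_iff₀ τ0]; linarith)
    have h2 : ‖a‖ ≤ 1 / 10 := by nlinarith [norm_nonneg a]
    have h3 : ‖(1 : ℂ)‖ ≤ ‖c‖ + (‖k.kappa τ‖ + ‖a‖) := by
      rw [show (1 : ℂ) = -(c + (k.kappa τ + a)) by rw [hc]; ring, norm_neg]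
      exact (norm_add_le _ _).trans (add_le_add_right (norm_add_le _ _) _)
    rw [norm_one] at h3
    linarith
  obtain ⟨z, hv, hz⟩ := k.exists_state τ0
    (u := (c / τ) • sinWave τ + a • (ramp * cosWave τ))
    (u' := (c / τ) • (τ : ℂ) • cosWave τ +
      a • (1 * cosWave τ + ramp * (-(τ : ℂ) • sinWave τ)))
    (u'' := (c / τ) • (τ : ℂ) • -(τ : ℂ) • sinWave τ +
      a • (1 * (-(τ : ℂ) • sinWave τ) +
        (1 * (-(τ : ℂ) • sinWave τ) + ramp * (-(τ : ℂ) • (τ : ℂ) • cosWave τ))))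
    (w := l⁻¹ • (expDecay l - ε • 1))
    (w' := l⁻¹ • (-l • expDecay l))
    (w'' := l⁻¹ • (-l • -l • expDecay l))
    (fun x => ((hasDerivAt_sinWave τ x).const_smul _).add
      (((hasDerivAt_ramp x).mul (hasDerivAt_cosWave τ x)).const_smul a))
    (fun x => (((hasDerivAt_cosWave τ x).const_smul _).const_smul _).add
      (((((hasDerivAt_cosWave τ x).const_mul 1)).add ((hasDerivAt_ramp x).mul
        ((hasDerivAt_sinWave τ x).const_smul _))).const_smul a))
    (fun x => ((hasDerivAt_expDecay l x).sub_const (ε • (1 : ℂ))).const_smul l⁻¹)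
    (fun x => ((hasDerivAt_expDecay l x).const_smul _).const_smul _)
    (by simp [sinWave, ramp])
    (by simp [← hε])
    (by
      have h1 : cosWave τ 0 = 1 := by rw [cosWave_zero, hcos, Complex.ofReal_one]
      have h2 : sinWave τ 0 = 0 := by rw [sinWave_zero, hsin, Complex.ofReal_zero]
      simp only [ContinuousMap.add_apply, ContinuousMap.smul_apply, ContinuousMap.mul_apply, h1, h2,
        expDecay_zero, smul_eq_mul, ContinuousMap.one_apply, hc]
      field_simp
      ring)
    (by
      have h1 : cosWave τ 0 = 1 := by rw [cosWave_zero, hcos, Complex.ofReal_one]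
      have h2 : sinWave τ 0 = 0 := by rw [sinWave_zero, hsin, Complex.ofReal_zero]
      have h3 : ramp 0 = 1 := by simp [ramp]
      simp only [ContinuousMap.add_apply, ContinuousMap.sub_apply, ContinuousMap.smul_apply,
        ContinuousMap.mul_apply, h1, h2, h3, expDecay_zero, smul_eq_mul, ContinuousMap.one_apply, ha]
      field_simp [Complex.I_ne_zero]
      ring)
  refine ⟨z, ?_, ?_⟩
  · refine le_trans ?_ (norm_v_le (z : k.StateSpace))
    have e : contL2 (-1) 0 ((Complex.I * τ) • ((c / τ) • sinWave τ + a • (ramp * cosWave τ))) =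
        (Complex.I * c) • contL2 (-1) 0 (sinWave τ) +
          (Complex.I * τ * a) • contL2 (-1) 0 (ramp * cosWave τ) := by
      rw [← map_smul, ← map_smul, ← map_add]
      refine congrArg _ (ContinuousMap.ext fun x => ?_)
      simp only [ContinuousMap.add_apply, ContinuousMap.smul_apply, smul_eq_mul]
      field_simp
    have h1 : ‖contL2 (-1) 0 (ramp * cosWave τ)‖ ≤ 1 :=
      norm_contL2_le (by norm_num) _ zero_le_one fun x hx => by
        rw [ContinuousMap.mul_apply, norm_mul]
        exact mul_le_one₀ (norm_ramp_le hx) (norm_nonneg _) (norm_cosWave_le τ x)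
    have h2 : 7 / 10 ≤ ‖contL2 (-1) 0 (sinWave τ)‖ := by
      refine le_of_sq_le_sq ?_ (norm_nonneg _)
      rw [norm_sq_contL2_sinWave τ0.ne' hsin]; norm_num
    have h3 := norm_sub_le
      ((Complex.I * c) • contL2 (-1) 0 (sinWave τ) +
          (Complex.I * τ * a) • contL2 (-1) 0 (ramp * cosWave τ))
      ((Complex.I * τ * a) • contL2 (-1) 0 (ramp * cosWave τ))
    rw [add_sub_cancel_right, norm_smul, norm_smul, norm_mul, norm_mul, norm_mul, Complex.norm_I,
      one_mul, one_mul, Complex.norm_of_nonneg τ0.le] at h3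
    rw [hv, e]
    nlinarith [norm_nonneg a, norm_nonneg c, mul_nonneg τ0.le (norm_nonneg a)]
  · rw [hz]
    refine (norm_mk_zero_zero_le _ _).trans ?_
    have h1 : ‖contL2 (-1) 0 ((Complex.I * τ) • (Complex.I * τ) •
        ((c / τ) • sinWave τ + a • (ramp * cosWave τ)) -
        ((c / τ) • (τ : ℂ) • -(τ : ℂ) • sinWave τ + a • (1 * (-(τ : ℂ) • sinWave τ) +
        (1 * (-(τ : ℂ) • sinWave τ) + ramp * (-(τ : ℂ) • (τ : ℂ) • cosWave τ)))))‖ ≤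
        4 / √τ := by
      refine norm_contL2_le (by norm_num) _ (by positivity) fun x hx => ?_
      have e : ∀ S C P : ℂ, Complex.I * τ * (Complex.I * τ * (c / τ * S + a * (P * C))) -
          (c / τ * (τ * (-τ * S)) + a * (1 * (-τ * S) + (1 * (-τ * S) + P * (-τ * (τ * C))))) =
          2 * (τ * a) * S := fun S C P => by
        linear_combination (τ * τ * (c / τ * S + a * (P * C))) * Complex.I_sq
      simp only [ContinuousMap.add_apply, ContinuousMap.sub_apply, ContinuousMap.smul_apply,
        ContinuousMap.mul_apply, smul_eq_mul, ContinuousMap.one_apply]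
      rw [e, norm_mul, norm_mul, norm_mul, Complex.norm_of_nonneg τ0.le, Complex.norm_ofNat]
      calc 2 * (τ * ‖a‖) * ‖sinWave τ x‖ ≤ 2 * (2 / √τ) * 1 := by
            gcongr
            exact norm_sinWave_le τ x
        _ = 4 / √τ := by ring
    have h2 : ‖contL2 0 1 ((Complex.I * τ) • l⁻¹ • (expDecay l - ε • 1) -
        (1 + k.kappa τ) • l⁻¹ • (-l • -l • expDecay l))‖ ≤ (4 + 2 * m) / √τ := by
      refine norm_contL2_le (by norm_num) _ (by positivity) fun x hx => ?_
      -- Since `l² = iτ`, only the memory term `κ w''` and the constant `ε / l` leave a residual.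
      have e : ∀ y : ℂ, Complex.I * τ * (l⁻¹ * (y - ε * 1)) -
          (1 + k.kappa τ) * (l⁻¹ * (-l * (-l * y))) = l * (-k.kappa τ * y - ε) := fun y => by
        rw [← ll]; field_simp; ring
      simp only [ContinuousMap.sub_apply, ContinuousMap.smul_apply, smul_eq_mul,
        ContinuousMap.one_apply]
      rw [e, norm_mul, nl]
      have h3 : ‖-k.kappa τ * expDecay l x - ε‖ ≤ 2 / τ * m * 1 + 4 / τ := by
        refine (norm_sub_le _ _).trans (add_le_add ?_ nε)
        rw [norm_mul, norm_neg]
        exact mul_le_mul nκ (norm_expDecay_decayRate_le τ hx.1.le) (norm_nonneg _) (by positivity)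
      calc √τ * ‖-k.kappa τ * expDecay l x - ε‖ ≤ √τ * (2 / τ * m * 1 + 4 / τ) := by gcongr
        _ = (4 + 2 * m) / √τ := by
          rw [eq_div_iff q0.ne', mul_right_comm, qq]; field_simp; ring
    calc _ ≤ 4 / √τ + (4 + 2 * m) / √τ := add_le_add h1 h2
      _ = (8 + 2 * m) / √τ := by ring

end WaveCG

theorem theorem3p4 (k : WaveCG.MemoryKernel)
    (hσ : WaveCG.spectrumOf k.systemOp ⊆ {ζ : ℂ | ζ.re < 0}) :
    0 < limsup (fun s : ℝ =>
      ((s ^ (-(1 / 2) : ℝ) * ‖WaveCG.resolventOf k.systemOp (Complex.I * s)‖ : ℝ) : EReal))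
      atTop := by
  set m := k.measure.real univ with hm
  have m0 : 0 ≤ m := measureReal_nonneg
  have hC : 0 < 1 / (4 * (8 + 2 * m)) := by positivity
  refine (EReal.coe_pos.2 hC).trans_le (le_limsup_of_frequently_le ?_)
  have htop : Tendsto (fun n : ℕ => (n : ℝ) * (2 * Real.pi)) atTop atTop :=
    tendsto_natCast_atTop_atTop.atTop_mul_const Real.two_pi_pos
  refine htop.frequently (Eventually.frequently ?_)
  filter_upwards [htop.eventually_ge_atTop (400 + 8 * m)] with n hn
  set τ : ℝ := n * (2 * Real.pi) with hτ
  have hsin : Real.sin τ = 0 := by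
    rw [hτ, show (n : ℝ) * (2 * Real.pi) = ((2 * n : ℕ) : ℝ) * Real.pi by push_cast; ring]
    exact Real.sin_nat_mul_pi _
  obtain ⟨z, hz, hres⟩ := k.exists_approx_eigenvector hsin (Real.cos_nat_mul_two_pi n) hn
  have hρ : Complex.I * (τ : ℂ) ∈ WaveCG.resolventSetOf k.systemOp := by
    by_contra h
    have := hσ h
    simp at this
  have h := WaveCG.norm_le_norm_resolventOf_mul hρ z
  have τ0 : 0 < τ := by linarith
  rw [EReal.coe_le_coe_iff, Real.rpow_neg τ0.le, ← Real.sqrt_eq_rpow, div_le_iff₀ (by positivity)]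
  calc (1 : ℝ) = 4 * (1 / 4) := by norm_num
    _ ≤ 4 * (‖WaveCG.resolventOf k.systemOp (Complex.I * τ)‖ * ((8 + 2 * m) / √τ)) := by
      gcongr
      exact hz.trans (h.trans (by gcongr))
    _ = _ := by ring
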